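/- All topological groups and topological vector spaces are Hausdorff, and topological vector spaces are over $\mathbb{R}$. An extension of topological abelian groups is a short exact sequence $0\to H\xrightarrow{\imath} X\xrightarrow{\pi} G\to 0$ of topological abelian groups in which the homomorphisms $\imath$ and $\pi$ are continuous and open onto their images; it is an extension of topological vector spaces if $H,X,G$ are topological vector spaces and $\imath,\pi$ are linear. Two extensions $0\to H\xrightarrow{\imath} X\xrightarrow{\pi} G\to 0$ and $0\to H\xrightarrow{\imath'} X'\xrightarrow{\pi'} G\to 0$ are equivalent if there is a continuous homomorphism (continuous linear map, in the case of topological vector spaces) $T:X\to X'$ with $T\circ\imath=\imath'$ and $\pi'\circ T=\pi$. Let $\mathrm{Ext}(G,H)$ be the abelian group of equivalence classes of extensions of topological abelian groups $0\to H\to X\to G\to 0$ under the Baer sum, and, for topological vector spaces $Y,Z$, let $\mathrm{Ext}_{\mathrm{TVS}}(Z,Y)$ be the abelian group of equivalence classes of extensions of topological vector spaces $0\to Y\to X\to Z\to 0$ under the Baer sum. Let $Y$ and $Z$ be topological vector spaces such that one of the following holds: (i) $Y$ is a Fréchet space (metrizable, complete and locally convex) and $Z$ is metrizable; (ii) $Y$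 is complete and locally bounded (it has a bounded neighbourhood of zero) and $Z$ is locally bounded. Then forgetting the scalar multiplication induces an isomorphism of abelian groups $\mathrm{Ext}_{\mathrm{TVS}}(Z,Y)\cong \mathrm{Ext}(Z,Y)$. Moreover, for every extension of topological abelian groups $0\to Y\xrightarrow{\imath} X\xrightarrow{\pi} Z\to 0$, the group $X$ admits a scalar multiplication that, with its given addition and topology, makes it a topological vector space and makes $\imath$ and $\pi$ linear. -/

import Mathlib

open Topology Filter

universe u v w

/-! ### Short exact sequences `0 → H → X → G → 0` of topological groups -/

/-- For homomorphisms `i : H → X` and `π : X → G` of topological abelian groups, `0 → H → X → G → 0`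
is an extension: it is exact, and both maps are continuous and open onto their images
(`i` is a topological embedding, `π` is surjective, continuous and open). -/
structure IsExtension {H X G : Type*} [TopologicalSpace H] [TopologicalSpace X]
    [TopologicalSpace G] [Zero G] (i : H → X) (π : X → G) : Prop where
  isEmbedding : IsEmbedding i
  isOpenQuotientMap : IsOpenQuotientMap π
  exact : Function.Exact i π

namespace IsExtension

/-- The middle group of an extension of Hausdorff groups is Hausdorff. -/
theorem t2Space {H X G : Type*} [AddCommGroup H] [TopologicalSpace H] [T2Space H]
    [AddCommGroup X] [TopologicalSpace X] [IsTopologicalAddGroup X]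
    [AddCommGroup G] [TopologicalSpace G] [T2Space G] (i : H →+ X) (π : X →+ G)
    (h : IsExtension i π) : T2Space X := by
  have : T1Space X := by
    refine IsTopologicalAddGroup.t1Space X ?_
    rw [← closure_subset_iff_isClosed]
    intro x hx
    have hπ : π x = 0 := by
      have hcl : IsClosed (π ⁻¹' {0}) := isClosed_singleton.preimage h.isOpenQuotientMap.continuous
      exact closure_minimal (by simp) hcl hx
    obtain ⟨y, rfl⟩ := (h.exact x).1 hπ
    have hy : y ∈ closure ({0} : Set H) := by
      rw [h.isEmbedding.isInducing.closure_eq_preimage_closure_image]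
      simpa using hx
    simp only [closure_singleton, Set.mem_singleton_iff] at hy
    simp [hy]
  infer_instance

/-- A morphism between two extensions of `G` by `H` is a homeomorphism. -/
theorem isHomeomorph {H X X' G : Type*} [AddCommGroup H] [TopologicalSpace H]
    [AddCommGroup X] [TopologicalSpace X] [IsTopologicalAddGroup X]
    [AddCommGroup X'] [TopologicalSpace X'] [IsTopologicalAddGroup X']
    [AddCommGroup G] [TopologicalSpace G] {i : H →+ X} {π : X →+ G} {i' : H →+ X'} {π' : X' →+ G}
    (h : IsExtension i π) (h' : IsExtension i' π') (T : X →+ X') (hT : Continuous T)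
    (hi : ∀ y, T (i y) = i' y) (hπ : ∀ x, π' (T x) = π x) : IsHomeomorph T := by
  refine ⟨hT, ?_, ?_, ?_⟩
  · rw [IsTopologicalAddGroup.isOpenMap_iff_nhds_zero]
    intro s hs
    rw [mem_map] at hs
    obtain ⟨V, hV, hVs⟩ := exists_nhds_zero_half hs
    have h1 : i ⁻¹' V ∈ 𝓝 (0 : H) :=
      h.isEmbedding.continuous.continuousAt.preimage_mem_nhds (by simpa using hV)
    rw [h'.isEmbedding.isInducing.nhds_eq_comap, mem_comap, map_zero] at h1
    obtain ⟨N, hN, hNV⟩ := h1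
    obtain ⟨W', hW', hWN⟩ := exists_nhds_half_neg hN
    have hW : V ∩ T ⁻¹' W' ∈ 𝓝 (0 : X) :=
      inter_mem hV (hT.continuousAt.preimage_mem_nhds (by simpa using hW'))
    have hG : π '' (V ∩ T ⁻¹' W') ∈ 𝓝 (0 : G) := by
      simpa using h.isOpenQuotientMap.isOpenMap.image_mem_nhds hW
    have hG' : π' ⁻¹' (π '' (V ∩ T ⁻¹' W')) ∈ 𝓝 (0 : X') :=
      h'.isOpenQuotientMap.continuous.continuousAt.preimage_mem_nhds (by simpa using hG)
    filter_upwards [hW', hG'] with x' hx' hx''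
    obtain ⟨z, ⟨hzV, hzW⟩, hz⟩ := hx''
    have hk : π' (x' - T z) = 0 := by rw [map_sub, hπ, hz, sub_self]
    obtain ⟨y, hy⟩ := (h'.exact _).1 hk
    have hyV : i y ∈ V := hNV (by
      change i' y ∈ N
      rw [hy]; exact hWN _ hx' _ hzW)
    have := hVs _ hzV _ hyV
    rwa [Set.mem_preimage, map_add, hi, hy, add_sub_cancel] at this
  · rw [injective_iff_map_eq_zero]
    intro x hx
    obtain ⟨y, rfl⟩ := (h.exact x).1 (by rw [← hπ, hx, map_zero])
    rw [hi] at hx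
    have : y = 0 := h'.isEmbedding.injective (by rw [hx, map_zero])
    rw [this, map_zero]
  · intro x'
    obtain ⟨x, hx⟩ := h.isOpenQuotientMap.surjective (π' x')
    obtain ⟨y, hy⟩ := (h'.exact (x' - T x)).1 (by rw [map_sub, hπ, hx, sub_self])
    exact ⟨x + i y, by rw [map_add, hi, hy, add_sub_cancel]⟩

theorem prodMap {H₁ X₁ G₁ H₂ X₂ G₂ : Type*}
    [TopologicalSpace H₁] [TopologicalSpace X₁] [TopologicalSpace G₁] [Zero G₁]
    [TopologicalSpace H₂] [TopologicalSpace X₂] [TopologicalSpace G₂] [Zero G₂]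
    {i₁ : H₁ → X₁} {π₁ : X₁ → G₁} {i₂ : H₂ → X₂} {π₂ : X₂ → G₂}
    (h₁ : IsExtension i₁ π₁) (h₂ : IsExtension i₂ π₂) :
    IsExtension (Prod.map i₁ i₂) (Prod.map π₁ π₂) where
  isEmbedding := h₁.isEmbedding.prodMap h₂.isEmbedding
  isOpenQuotientMap := h₁.isOpenQuotientMap.prodMap h₂.isOpenQuotientMap
  exact := by
    rintro ⟨a, b⟩
    have ha := h₁.exact a
    have hb := h₂.exact b
    simp only [Prod.map_apply, Prod.mk_eq_zero, ha, hb, Set.range_prodMap, Set.mem_prod]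

theorem pullback {H X G G' P : Type*} [AddCommGroup H] [TopologicalSpace H]
    [AddCommGroup X] [TopologicalSpace X] [AddCommGroup G] [TopologicalSpace G]
    [AddCommGroup G'] [TopologicalSpace G'] [TopologicalSpace P]
    {i : H →+ X} {π : X →+ G} (h : IsExtension i π) (t : G' →+ G) (ht : Continuous t)
    (e : P → X × G') (he : IsEmbedding e)
    (hr : ∀ p, p ∈ Set.range e ↔ π p.1 = t p.2) (I : H → P) (hI : ∀ y, e (I y) = (i y, 0)) :
    IsExtension I (fun p => (e p).2) where
  isEmbedding := by
    have hc : Continuous I := by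
      rw [he.continuous_iff]
      have : e ∘ I = fun y => (i y, 0) := funext hI
      rw [this]
      exact h.isEmbedding.continuous.prodMk continuous_const
    refine IsEmbedding.of_comp hc (continuous_fst.comp he.continuous) ?_
    have : (Prod.fst ∘ e) ∘ I = i := funext fun y => by simp [hI]
    rw [this]
    exact h.isEmbedding
  isOpenQuotientMap := by
    refine ⟨?_, continuous_snd.comp he.continuous, ?_⟩
    · intro g
      obtain ⟨x, hx⟩ := h.isOpenQuotientMap.surjective (t g)
      obtain ⟨p, hp⟩ := (hr (x, g)).2 hx
      exact ⟨p, by simp [hp]⟩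
    · rw [isOpenMap_iff_nhds_le]
      intro p s hs
      rw [mem_map, he.isInducing.nhds_eq_comap, mem_comap] at hs
      obtain ⟨W, hW, hWs⟩ := hs
      obtain ⟨U, hU, V, hV, hUV⟩ := mem_nhds_prod_iff.1 hW
      have hp : π (e p).1 = t (e p).2 := (hr _).1 ⟨p, rfl⟩
      have h1 : π '' U ∈ 𝓝 (t (e p).2) := hp ▸ h.isOpenQuotientMap.isOpenMap.image_mem_nhds hU
      filter_upwards [hV, ht.continuousAt.preimage_mem_nhds h1] with g hg hg'
      obtain ⟨x, hxU, hx⟩ := hg'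
      obtain ⟨p', hp'⟩ := (hr (x, g)).2 hx
      have : p' ∈ e ⁻¹' W := by
        rw [Set.mem_preimage, hp']
        exact hUV ⟨hxU, hg⟩
      simpa [hp'] using hWs this
  exact := by
    intro p
    have hp : π (e p).1 = t (e p).2 := (hr _).1 ⟨p, rfl⟩
    constructor
    · intro h0
      replace h0 : (e p).2 = 0 := h0
      obtain ⟨y, hy⟩ := (h.exact (e p).1).1 (by rw [hp, h0, map_zero])
      exact ⟨y, he.injective (by rw [hI, hy]; exact Prod.ext rfl h0.symm)⟩
    · rintro ⟨y, rfl⟩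
      simp [hI]

theorem pushout {H X G H' P : Type*} [AddCommGroup H] [TopologicalSpace H]
    [AddCommGroup X] [TopologicalSpace X] [IsTopologicalAddGroup X]
    [AddCommGroup G] [TopologicalSpace G]
    [AddCommGroup H'] [TopologicalSpace H'] [IsTopologicalAddGroup H']
    [AddCommGroup P] [TopologicalSpace P] [IsTopologicalAddGroup P]
    {i : H →+ X} {π : X →+ G} (h : IsExtension i π) (t : H →+ H') (ht : Continuous t)
    (q : H' × X →+ P) (hq : IsOpenQuotientMap q)
    (hker : ∀ a, q a = 0 ↔ ∃ y, a = (t y, -i y)) (r : H' →+ P) (hr : ∀ y, r y = q (y, 0))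
    (p : P →+ G) (hp : ∀ a, p (q a) = π a.2) : IsExtension r p where
  isEmbedding := by
    have hinj : Function.Injective r := by
      rw [injective_iff_map_eq_zero]
      intro y hy
      rw [hr, hker] at hy
      obtain ⟨z, hz⟩ := hy
      rw [Prod.mk.injEq] at hz
      have : z = 0 := h.isEmbedding.injective (by rw [map_zero, ← neg_eq_zero, ← hz.2])
      rw [hz.1, this, map_zero]
    have hc : Continuous r := by
      have : (r : H' → P) = fun y => q (y, 0) := funext hr
      rw [this]
      exact hq.continuous.comp (continuous_id.prodMk continuous_const)
    refine ⟨IsTopologicalAddGroup.isInducing_iff_nhds_zero.2 (le_antisymm ?_ ?_), hinj⟩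
    · rw [← map_le_iff_le_comap]
      have := hc.tendsto 0
      rwa [map_zero] at this
    · intro U hU
      obtain ⟨V, hV, hVU⟩ := exists_nhds_zero_half hU
      have h1 : t ⁻¹' V ∈ 𝓝 (0 : H) :=
        ht.continuousAt.preimage_mem_nhds (by simpa using hV)
      rw [h.isEmbedding.isInducing.nhds_eq_comap, mem_comap, map_zero] at h1
      obtain ⟨N, hN, hNV⟩ := h1
      have h2 : V ×ˢ N ∈ 𝓝 (0 : H' × X) := prod_mem_nhds hV hN
      have h3 : q '' (V ×ˢ N) ∈ 𝓝 (0 : P) := by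
        simpa using hq.isOpenMap.image_mem_nhds h2
      refine mem_comap.2 ⟨_, h3, ?_⟩
      rintro y ⟨⟨a, x⟩, ⟨ha, hx⟩, hax⟩
      have hd : q ((y, 0) - (a, x)) = 0 := by rw [map_sub, ← hr, hax, sub_self]
      obtain ⟨z, hz⟩ := (hker _).1 hd
      simp only [Prod.mk_sub_mk, zero_sub, Prod.mk.injEq, neg_inj] at hz
      have hz' : t z ∈ V := hNV (by change i z ∈ N; rw [← hz.2]; exact hx)
      have := hVU _ ha _ hz'
      rwa [← hz.1, add_sub_cancel] at this
  isOpenQuotientMap := by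
    have : (p : P → G) ∘ q = fun a => π a.2 := funext hp
    rw [← IsOpenQuotientMap.of_comp_iff hq, this]
    exact h.isOpenQuotientMap.comp isOpenQuotientMap_snd
  exact := by
    intro b
    obtain ⟨⟨a, x⟩, rfl⟩ := hq.surjective b
    rw [hp]
    constructor
    · intro hx
      obtain ⟨z, rfl⟩ := (h.exact x).1 hx
      refine ⟨a + t z, ?_⟩
      rw [hr, ← sub_eq_zero, ← map_sub, hker]
      exact ⟨z, by simp⟩
    · rintro ⟨y, hy⟩
      rw [← hp, ← hy, hr, hp, map_zero]

end IsExtension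

/-! ### Extensions of topological abelian groups -/

/-- An extension `0 → H → X → G → 0` of (Hausdorff) topological abelian groups.
The middle group has the cardinality of `H × G`, so this universe holds all of them. -/
structure GroupExt (G : Type u) (H : Type v) [AddCommGroup G] [TopologicalSpace G]
    [AddCommGroup H] [TopologicalSpace H] : Type (max u v + 1) where
  X : Type (max u v)
  [addCommGroup : AddCommGroup X]
  [topologicalSpace : TopologicalSpace X]
  [isTopologicalAddGroup : IsTopologicalAddGroup X]
  [t2Space : T2Space X]
  incl : H →+ X
  proj : X →+ G
  isExtension : IsExtension incl proj

namespace GroupExt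

attribute [instance] addCommGroup topologicalSpace isTopologicalAddGroup t2Space

variable {G G' : Type u} {H H' : Type v}
  [AddCommGroup G] [TopologicalSpace G] [AddCommGroup G'] [TopologicalSpace G']
  [AddCommGroup H] [TopologicalSpace H] [AddCommGroup H'] [TopologicalSpace H']

/-- `E` and `E'` are equivalent if some continuous homomorphism `T : X → X'` satisfies
`T ∘ i = i'` and `π' ∘ T = π`. -/
def Equivalent (E E' : GroupExt G H) : Prop :=
  ∃ T : E.X →ₜ+ E'.X, (∀ y, T (E.incl y) = E'.incl y) ∧ ∀ x, E'.proj (T x) = E.proj x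

theorem equivalence : Equivalence (Equivalent (G := G) (H := H)) where
  refl E := ⟨ContinuousAddMonoidHom.id _, fun _ => rfl, fun _ => rfl⟩
  symm := by
    rintro E E' ⟨T, hi, hπ⟩
    have hT : IsHomeomorph (T : E.X →+ E'.X) :=
      E.isExtension.isHomeomorph E'.isExtension (T : E.X →+ E'.X) T.continuous_toFun hi hπ
    let S : E.X ≃+ E'.X := AddEquiv.ofBijective (T : E.X →+ E'.X) hT.bijective
    have hS : ∀ x, S x = T x := fun _ => rfl
    have hc : Continuous S.symm := by
      rw [continuous_def]
      intro s hs
      have : S.symm ⁻¹' s = (T : E.X →+ E'.X) '' s := by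
        ext x
        constructor
        · intro hx
          exact ⟨S.symm x, hx, S.apply_symm_apply x⟩
        · rintro ⟨y, hy, rfl⟩
          change S.symm (S y) ∈ s
          rwa [S.symm_apply_apply]
      rw [this]
      exact hT.isOpenMap s hs
    refine ⟨⟨S.symm.toAddMonoidHom, hc⟩, fun y => ?_, fun x => ?_⟩
    · change S.symm _ = _
      rw [S.symm_apply_eq, hS, hi]
    · change E.proj (S.symm x) = _
      rw [← hπ, ← hS, S.apply_symm_apply]
  trans := by
    rintro E E' E'' ⟨T, hi, hπ⟩ ⟨T', hi', hπ'⟩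
    exact ⟨T'.comp T, fun y => by simp [hi, hi'], fun x => by simp [hπ, hπ']⟩

instance setoid (G : Type u) (H : Type v) [AddCommGroup G] [TopologicalSpace G]
    [AddCommGroup H] [TopologicalSpace H] : Setoid (GroupExt G H) := ⟨Equivalent, equivalence⟩

/-- The product extension `0 → H × H' → X × X' → G × G' → 0`. -/
def prod (E : GroupExt G H) (E' : GroupExt G' H') : GroupExt (G × G') (H × H') where
  X := E.X × E'.X
  incl := E.incl.prodMap E'.incl
  proj := E.proj.prodMap E'.proj
  isExtension := E.isExtension.prodMap E'.isExtension

/-- The pull-back extension `E t`, with middle group `{(x, g) | π x = t g}`. -/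
def pullback [T2Space G'] [IsTopologicalAddGroup G'] (E : GroupExt G H) (t : G' →ₜ+ G) :
    GroupExt G' H where
  X := (E.proj.comp (AddMonoidHom.fst E.X G')).eqLocus
    ((t : G' →+ G).comp (AddMonoidHom.snd E.X G'))
  incl := (E.incl.prod 0).codRestrict _ fun y => by
    change E.proj (E.incl y) = t 0
    rw [map_zero, (E.isExtension.exact _).2 ⟨y, rfl⟩]
  proj := (AddMonoidHom.snd E.X G').comp (AddSubgroup.subtype _)
  isExtension := E.isExtension.pullback (t : G' →+ G) t.continuous_toFun Subtype.val
    IsEmbedding.subtypeVal (fun p => by rw [Subtype.range_coe]; rfl) _ fun _ => rfl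

/-- The relation subgroup `{(t y, -i y)}` of the push-out. -/
def pushoutRel (E : GroupExt G H) (t : H →ₜ+ H') : AddSubgroup (H' × E.X) :=
  ((t : H →+ H').prod (-E.incl)).range

/-- The push-out extension `t E`, with middle group `(H' × X) / {(t y, -i y)}`. -/
def pushout [T2Space G] [IsTopologicalAddGroup H'] [T2Space H'] (E : GroupExt G H)
    (t : H →ₜ+ H') : GroupExt G H' :=
  let r : H' →+ (H' × E.X) ⧸ E.pushoutRel t :=
    (QuotientAddGroup.mk' (E.pushoutRel t)).comp (AddMonoidHom.inl H' E.X)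
  let p : (H' × E.X) ⧸ E.pushoutRel t →+ G :=
    QuotientAddGroup.lift (E.pushoutRel t) (E.proj.comp (AddMonoidHom.snd H' E.X)) (by
      rintro _ ⟨y, rfl⟩
      change E.proj (-E.incl y) = 0
      rw [map_neg, (E.isExtension.exact _).2 ⟨y, rfl⟩, neg_zero])
  have h : IsExtension r p :=
    E.isExtension.pushout (t : H →+ H') t.continuous_toFun (QuotientAddGroup.mk' (E.pushoutRel t))
      QuotientAddGroup.isOpenQuotientMap_mk
      (fun a => by
        rw [QuotientAddGroup.mk'_apply, QuotientAddGroup.eq_zero_iff]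
        exact exists_congr fun y => eq_comm)
      r (fun _ => rfl) p fun _ => rfl
  { X := (H' × E.X) ⧸ E.pushoutRel t
    t2Space := h.t2Space r p
    incl := r
    proj := p
    isExtension := h }

/-- The diagonal `Δ : G → G × G`. -/
def diag (G : Type u) [AddCommGroup G] [TopologicalSpace G] : G →ₜ+ G × G :=
  (ContinuousAddMonoidHom.id G).prod (ContinuousAddMonoidHom.id G)

/-- The codiagonal `∇ : H × H → H`, `(h, h') ↦ h + h'`. -/
def codiag (H : Type v) [AddCommGroup H] [TopologicalSpace H] [IsTopologicalAddGroup H] :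
    H × H →ₜ+ H :=
  ⟨(AddMonoidHom.id H).coprod (AddMonoidHom.id H), continuous_fst.add continuous_snd⟩

/-- The Baer sum `∇ ((E₁ × E₂) Δ)`. -/
def baerSum [IsTopologicalAddGroup G] [T2Space G] [IsTopologicalAddGroup H] [T2Space H]
    (E₁ E₂ : GroupExt G H) : GroupExt G H :=
  ((E₁.prod E₂).pullback (diag G)).pushout (codiag H)

theorem prod_congr {E₁ E₂ : GroupExt G H} {E₁' E₂' : GroupExt G' H'}
    (h : E₁.Equivalent E₂) (h' : E₁'.Equivalent E₂') :
    (E₁.prod E₁').Equivalent (E₂.prod E₂') := by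
  obtain ⟨T, hi, hπ⟩ := h
  obtain ⟨T', hi', hπ'⟩ := h'
  exact ⟨T.prodMap T', fun y => Prod.ext (hi y.1) (hi' y.2),
    fun x => Prod.ext (hπ x.1) (hπ' x.2)⟩

theorem pullback_congr [T2Space G'] [IsTopologicalAddGroup G'] {E₁ E₂ : GroupExt G H}
    (t : G' →ₜ+ G) (h : E₁.Equivalent E₂) : (E₁.pullback t).Equivalent (E₂.pullback t) := by
  obtain ⟨T, hi, hπ⟩ := h
  let S : (E₁.pullback t).X →+ (E₂.pullback t).X :=
    (((T : E₁.X →+ E₂.X).prodMap (AddMonoidHom.id G')).comp (AddSubgroup.subtype _)).codRestrict _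
      fun x => (hπ x.1.1).trans x.2
  have hS : Continuous S := by
    refine Continuous.subtype_mk ?_ _
    exact (T.continuous_toFun.prodMap continuous_id).comp continuous_subtype_val
  exact ⟨⟨S, hS⟩, fun y => Subtype.ext (Prod.ext (hi y) rfl), fun x => rfl⟩

theorem pushout_congr [T2Space G] [IsTopologicalAddGroup H'] [T2Space H'] {E₁ E₂ : GroupExt G H}
    (t : H →ₜ+ H') (h : E₁.Equivalent E₂) : (E₁.pushout t).Equivalent (E₂.pushout t) := by
  obtain ⟨T, hi, hπ⟩ := h
  let S : (H' × E₁.X) ⧸ E₁.pushoutRel t →+ (H' × E₂.X) ⧸ E₂.pushoutRel t :=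
    QuotientAddGroup.map _ _ ((AddMonoidHom.id H').prodMap (T : E₁.X →+ E₂.X)) (by
      rintro _ ⟨y, rfl⟩
      refine ⟨y, Prod.ext rfl ?_⟩
      change -E₂.incl y = T (-E₁.incl y)
      rw [map_neg, hi])
  have hS : Continuous S := by
    refine QuotientAddGroup.isOpenQuotientMap_mk.continuous_comp_iff.1 ?_
    exact QuotientAddGroup.isOpenQuotientMap_mk.continuous.comp
      (continuous_id.prodMap T.continuous_toFun)
  refine ⟨⟨S, hS⟩, fun y => ?_, fun x => ?_⟩
  · exact congrArg (QuotientAddGroup.mk (s := E₂.pushoutRel t)) (Prod.ext rfl (map_zero T))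
  · obtain ⟨a, rfl⟩ := QuotientAddGroup.mk_surjective x
    exact hπ a.2

theorem baerSum_congr [IsTopologicalAddGroup G] [T2Space G] [IsTopologicalAddGroup H] [T2Space H]
    {E₁ E₂ E₁' E₂' : GroupExt G H} (h : E₁.Equivalent E₁') (h' : E₂.Equivalent E₂') :
    (E₁.baerSum E₂).Equivalent (E₁'.baerSum E₂') :=
  pushout_congr _ (pullback_congr _ (prod_congr h h'))

end GroupExt

/-- `Ext(G, H)`: equivalence classes of extensions `0 → H → X → G → 0` of topological abelian
groups, with the Baer sum. -/
def ExtGroup (G : Type u) (H : Type v) [AddCommGroup G] [TopologicalSpace G]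
    [AddCommGroup H] [TopologicalSpace H] : Type (max u v + 1) :=
  Quotient (GroupExt.setoid G H)

/-- The class `[E]` in `Ext(G, H)`. -/
def GroupExt.toExt {G : Type u} {H : Type v} [AddCommGroup G] [TopologicalSpace G]
    [AddCommGroup H] [TopologicalSpace H] (E : GroupExt G H) : ExtGroup G H :=
  Quotient.mk (GroupExt.setoid G H) E

instance ExtGroup.instAdd (G : Type u) (H : Type v) [AddCommGroup G] [TopologicalSpace G]
    [IsTopologicalAddGroup G] [T2Space G] [AddCommGroup H] [TopologicalSpace H]
    [IsTopologicalAddGroup H] [T2Space H] : Add (ExtGroup G H) :=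
  ⟨Quotient.map₂ GroupExt.baerSum fun _ _ h _ _ h' => GroupExt.baerSum_congr h h'⟩

/-! ### Extensions of topological vector spaces -/

/-- An extension `0 → Y → X → Z → 0` of (Hausdorff, real) topological vector spaces: an extension
of topological abelian groups with linear maps. -/
structure TVSExt (Z : Type u) (Y : Type v) [AddCommGroup Z] [Module ℝ Z] [TopologicalSpace Z]
    [AddCommGroup Y] [Module ℝ Y] [TopologicalSpace Y] : Type (max u v + 1) where
  X : Type (max u v)
  [addCommGroup : AddCommGroup X]
  [module : Module ℝ X]
  [topologicalSpace : TopologicalSpace X]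
  [isTopologicalAddGroup : IsTopologicalAddGroup X]
  [continuousSMul : ContinuousSMul ℝ X]
  [t2Space : T2Space X]
  incl : Y →ₗ[ℝ] X
  proj : X →ₗ[ℝ] Z
  isExtension : IsExtension incl proj

namespace TVSExt

attribute [instance] addCommGroup module topologicalSpace isTopologicalAddGroup continuousSMul
  t2Space

variable {Z Z' : Type u} {Y Y' : Type v}
  [AddCommGroup Z] [Module ℝ Z] [TopologicalSpace Z]
  [AddCommGroup Z'] [Module ℝ Z'] [TopologicalSpace Z']
  [AddCommGroup Y] [Module ℝ Y] [TopologicalSpace Y]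
  [AddCommGroup Y'] [Module ℝ Y'] [TopologicalSpace Y']

/-- The underlying extension of topological abelian groups. -/
def toGroupExt (E : TVSExt Z Y) : GroupExt Z Y where
  X := E.X
  incl := E.incl.toAddMonoidHom
  proj := E.proj.toAddMonoidHom
  isExtension := E.isExtension

/-- `E` and `E'` are equivalent if some continuous linear map `T : X → X'` satisfies
`T ∘ i = i'` and `π' ∘ T = π`. -/
def Equivalent (E E' : TVSExt Z Y) : Prop :=
  ∃ T : E.X →L[ℝ] E'.X, (∀ y, T (E.incl y) = E'.incl y) ∧ ∀ x, E'.proj (T x) = E.proj x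

theorem Equivalent.toGroupExt {E E' : TVSExt Z Y} (h : E.Equivalent E') :
    E.toGroupExt.Equivalent E'.toGroupExt := by
  obtain ⟨T, hi, hπ⟩ := h
  exact ⟨⟨T.toLinearMap.toAddMonoidHom, T.continuous⟩, hi, hπ⟩

theorem equivalence : Equivalence (Equivalent (Z := Z) (Y := Y)) where
  refl E := ⟨ContinuousLinearMap.id ℝ _, fun _ => rfl, fun _ => rfl⟩
  symm := by
    rintro E E' ⟨T, hi, hπ⟩
    have hT : IsHomeomorph (T : E.X → E'.X) :=
      IsExtension.isHomeomorph (i := E.incl.toAddMonoidHom) (π := E.proj.toAddMonoidHom)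
        (i' := E'.incl.toAddMonoidHom) (π' := E'.proj.toAddMonoidHom) E.isExtension E'.isExtension
        T.toLinearMap.toAddMonoidHom T.continuous hi hπ
    let S : E.X ≃ₗ[ℝ] E'.X := LinearEquiv.ofBijective T.toLinearMap hT.bijective
    have hS : ∀ x, S x = T x := fun _ => rfl
    have hc : Continuous S.symm := by
      rw [continuous_def]
      intro s hs
      have : S.symm ⁻¹' s = T '' s := by
        ext x
        constructor
        · intro hx
          exact ⟨S.symm x, hx, by rw [← hS, S.apply_symm_apply]⟩
        · rintro ⟨y, hy, rfl⟩
          rwa [Set.mem_preimage, ← hS, S.symm_apply_apply]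
      rw [this]
      exact hT.isOpenMap s hs
    refine ⟨⟨S.symm.toLinearMap, hc⟩, fun y => ?_, fun x => ?_⟩
    · change S.symm _ = _
      rw [S.symm_apply_eq, hS, hi]
    · change E.proj (S.symm x) = _
      rw [← hπ, ← hS, S.apply_symm_apply]
  trans := by
    rintro E E' E'' ⟨T, hi, hπ⟩ ⟨T', hi', hπ'⟩
    exact ⟨T'.comp T, fun y => by simp [hi, hi'], fun x => by simp [hπ, hπ']⟩

instance setoid (Z : Type u) (Y : Type v) [AddCommGroup Z] [Module ℝ Z] [TopologicalSpace Z]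
    [AddCommGroup Y] [Module ℝ Y] [TopologicalSpace Y] : Setoid (TVSExt Z Y) :=
  ⟨Equivalent, equivalence⟩

/-- The product extension `0 → Y × Y' → X × X' → Z × Z' → 0`. -/
def prod (E : TVSExt Z Y) (E' : TVSExt Z' Y') : TVSExt (Z × Z') (Y × Y') where
  X := E.X × E'.X
  incl := E.incl.prodMap E'.incl
  proj := E.proj.prodMap E'.proj
  isExtension := E.isExtension.prodMap E'.isExtension

/-- The pull-back extension `E t`, with middle space `{(x, z) | π x = t z}`. -/
def pullback [T2Space Z'] [IsTopologicalAddGroup Z'] [ContinuousSMul ℝ Z'] (E : TVSExt Z Y)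
    (t : Z' →L[ℝ] Z) : TVSExt Z' Y where
  X := LinearMap.eqLocus (E.proj ∘ₗ LinearMap.fst ℝ E.X Z') (t.toLinearMap ∘ₗ LinearMap.snd ℝ E.X Z')
  incl := (E.incl.prod 0).codRestrict _ fun y => by
    change E.proj (E.incl y) = t 0
    rw [map_zero, (E.isExtension.exact _).2 ⟨y, rfl⟩]
  proj := LinearMap.snd ℝ E.X Z' ∘ₗ Submodule.subtype _
  isExtension := IsExtension.pullback (i := E.incl.toAddMonoidHom) (π := E.proj.toAddMonoidHom)
    E.isExtension t.toLinearMap.toAddMonoidHom t.continuous Subtype.val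
    IsEmbedding.subtypeVal (fun p => by rw [Subtype.range_coe]; rfl) _ fun _ => rfl

/-- The relation subspace `{(t y, -i y)}` of the push-out. -/
def pushoutRel (E : TVSExt Z Y) (t : Y →L[ℝ] Y') : Submodule ℝ (Y' × E.X) :=
  LinearMap.range (t.toLinearMap.prod (-E.incl))

/-- The push-out extension `t E`, with middle space `(Y' × X) / {(t y, -i y)}`. -/
def pushout [T2Space Z] [IsTopologicalAddGroup Y'] [ContinuousSMul ℝ Y'] [T2Space Y']
    (E : TVSExt Z Y) (t : Y →L[ℝ] Y') : TVSExt Z Y' :=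
  let r : Y' →ₗ[ℝ] (Y' × E.X) ⧸ E.pushoutRel t :=
    (E.pushoutRel t).mkQ ∘ₗ LinearMap.inl ℝ Y' E.X
  let p : (Y' × E.X) ⧸ E.pushoutRel t →ₗ[ℝ] Z :=
    (E.pushoutRel t).liftQ (E.proj ∘ₗ LinearMap.snd ℝ Y' E.X) (by
      rintro _ ⟨y, rfl⟩
      change E.proj (-E.incl y) = 0
      rw [map_neg, (E.isExtension.exact _).2 ⟨y, rfl⟩, neg_zero])
  have h : IsExtension r p :=
    IsExtension.pushout (i := E.incl.toAddMonoidHom) (π := E.proj.toAddMonoidHom) E.isExtension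
      t.toLinearMap.toAddMonoidHom t.continuous (E.pushoutRel t).mkQ.toAddMonoidHom
      (E.pushoutRel t).isOpenQuotientMap_mkQ
      (fun a => by
        change (E.pushoutRel t).mkQ a = 0 ↔ _
        rw [Submodule.mkQ_apply, Submodule.Quotient.mk_eq_zero]
        exact exists_congr fun y => eq_comm)
      r.toAddMonoidHom (fun _ => rfl) p.toAddMonoidHom fun _ => rfl
  { X := (Y' × E.X) ⧸ E.pushoutRel t
    t2Space := IsExtension.t2Space r.toAddMonoidHom p.toAddMonoidHom h
    incl := r
    proj := p
    isExtension := h }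

/-- The Baer sum `∇ ((E₁ × E₂) Δ)`, with `Δ z = (z, z)` and `∇ (y, y') = y + y'`. -/
def baerSum [IsTopologicalAddGroup Z] [ContinuousSMul ℝ Z] [T2Space Z]
    [IsTopologicalAddGroup Y] [ContinuousSMul ℝ Y] [T2Space Y]
    (E₁ E₂ : TVSExt Z Y) : TVSExt Z Y :=
  ((E₁.prod E₂).pullback ((ContinuousLinearMap.id ℝ Z).prod (ContinuousLinearMap.id ℝ Z))).pushout
    (ContinuousLinearMap.fst ℝ Y Y + ContinuousLinearMap.snd ℝ Y Y)

theorem prod_congr {E₁ E₂ : TVSExt Z Y} {E₁' E₂' : TVSExt Z' Y'}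
    (h : E₁.Equivalent E₂) (h' : E₁'.Equivalent E₂') :
    (E₁.prod E₁').Equivalent (E₂.prod E₂') := by
  obtain ⟨T, hi, hπ⟩ := h
  obtain ⟨T', hi', hπ'⟩ := h'
  exact ⟨T.prodMap T', fun y => Prod.ext (hi y.1) (hi' y.2),
    fun x => Prod.ext (hπ x.1) (hπ' x.2)⟩

theorem pullback_congr [T2Space Z'] [IsTopologicalAddGroup Z'] [ContinuousSMul ℝ Z']
    {E₁ E₂ : TVSExt Z Y} (t : Z' →L[ℝ] Z) (h : E₁.Equivalent E₂) :
    (E₁.pullback t).Equivalent (E₂.pullback t) := by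
  obtain ⟨T, hi, hπ⟩ := h
  let S : (E₁.pullback t).X →ₗ[ℝ] (E₂.pullback t).X :=
    ((T.toLinearMap.prodMap LinearMap.id) ∘ₗ Submodule.subtype _).codRestrict _
      fun x => (hπ x.1.1).trans x.2
  have hS : Continuous S := by
    refine Continuous.subtype_mk ?_ _
    exact (T.continuous.prodMap continuous_id).comp continuous_subtype_val
  exact ⟨⟨S, hS⟩, fun y => Subtype.ext (Prod.ext (hi y) rfl), fun x => rfl⟩

theorem pushout_congr [T2Space Z] [IsTopologicalAddGroup Y'] [ContinuousSMul ℝ Y'] [T2Space Y']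
    {E₁ E₂ : TVSExt Z Y} (t : Y →L[ℝ] Y') (h : E₁.Equivalent E₂) :
    (E₁.pushout t).Equivalent (E₂.pushout t) := by
  obtain ⟨T, hi, hπ⟩ := h
  let S : (Y' × E₁.X) ⧸ E₁.pushoutRel t →ₗ[ℝ] (Y' × E₂.X) ⧸ E₂.pushoutRel t :=
    Submodule.mapQ _ _ (LinearMap.id.prodMap T.toLinearMap) (by
      rintro _ ⟨y, rfl⟩
      refine ⟨y, Prod.ext rfl ?_⟩
      change -E₂.incl y = T (-E₁.incl y)
      rw [map_neg, hi])
  have hS : Continuous S := by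
    refine (E₁.pushoutRel t).isOpenQuotientMap_mkQ.continuous_comp_iff.1 ?_
    exact (E₂.pushoutRel t).isOpenQuotientMap_mkQ.continuous.comp
      (continuous_id.prodMap T.continuous)
  refine ⟨⟨S, hS⟩, fun y => ?_, fun x => ?_⟩
  · exact congrArg (E₂.pushoutRel t).mkQ (Prod.ext rfl (map_zero T))
  · obtain ⟨a, rfl⟩ := (E₁.pushoutRel t).mkQ_surjective x
    exact hπ a.2

theorem baerSum_congr [IsTopologicalAddGroup Z] [ContinuousSMul ℝ Z] [T2Space Z]
    [IsTopologicalAddGroup Y] [ContinuousSMul ℝ Y] [T2Space Y]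
    {E₁ E₂ E₁' E₂' : TVSExt Z Y} (h : E₁.Equivalent E₁') (h' : E₂.Equivalent E₂') :
    (E₁.baerSum E₂).Equivalent (E₁'.baerSum E₂') :=
  pushout_congr _ (pullback_congr _ (prod_congr h h'))

end TVSExt

/-- `Ext_TVS(Z, Y)`: equivalence classes of extensions `0 → Y → X → Z → 0` of topological vector
spaces, with the Baer sum. -/
def ExtTVS (Z : Type u) (Y : Type v) [AddCommGroup Z] [Module ℝ Z] [TopologicalSpace Z]
    [AddCommGroup Y] [Module ℝ Y] [TopologicalSpace Y] : Type (max u v + 1) :=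
  Quotient (TVSExt.setoid Z Y)

/-- The class `[E]` in `Ext_TVS(Z, Y)`. -/
def TVSExt.toExt {Z : Type u} {Y : Type v} [AddCommGroup Z] [Module ℝ Z] [TopologicalSpace Z]
    [AddCommGroup Y] [Module ℝ Y] [TopologicalSpace Y] (E : TVSExt Z Y) : ExtTVS Z Y :=
  Quotient.mk (TVSExt.setoid Z Y) E

instance ExtTVS.instAdd (Z : Type u) (Y : Type v) [AddCommGroup Z] [Module ℝ Z]
    [TopologicalSpace Z] [IsTopologicalAddGroup Z] [ContinuousSMul ℝ Z] [T2Space Z]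
    [AddCommGroup Y] [Module ℝ Y] [TopologicalSpace Y] [IsTopologicalAddGroup Y]
    [ContinuousSMul ℝ Y] [T2Space Y] : Add (ExtTVS Z Y) :=
  ⟨Quotient.map₂ TVSExt.baerSum fun _ _ h _ _ h' => TVSExt.baerSum_congr h h'⟩

/-! ### Classes of topological vector spaces -/

/-- A Fréchet space: metrizable, complete and locally convex. -/
structure IsFrechet (Y : Type*) [AddCommGroup Y] [Module ℝ Y] [UniformSpace Y] : Prop where
  metrizable : TopologicalSpace.MetrizableSpace Y
  complete : CompleteSpace Y
  locallyConvex : LocallyConvexSpace ℝ Y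

/-- A locally bounded topological vector space: some neighbourhood of zero is bounded. -/
def IsLocallyBounded (Y : Type*) [AddCommGroup Y] [Module ℝ Y] [TopologicalSpace Y] : Prop :=
  ∃ U ∈ 𝓝 (0 : Y), Bornology.IsVonNBounded ℝ U

/-- Forgetting the scalar multiplication induces an isomorphism `Ext_TVS(Z, Y) ≅ Ext(Z, Y)`. -/
def ForgetIsIso (Z : Type u) (Y : Type v) [AddCommGroup Z] [Module ℝ Z]
    [TopologicalSpace Z] [IsTopologicalAddGroup Z] [ContinuousSMul ℝ Z] [T2Space Z]
    [AddCommGroup Y] [Module ℝ Y] [TopologicalSpace Y] [IsTopologicalAddGroup Y]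
    [ContinuousSMul ℝ Y] [T2Space Y] : Prop :=
  ∃ e : ExtTVS Z Y ≃+ ExtGroup Z Y, ∀ E : TVSExt Z Y, e E.toExt = E.toGroupExt.toExt

/-- Every extension `0 → Y → X → Z → 0` of topological abelian groups (`X` in an arbitrary universe)
is an extension of topological vector spaces for some scalar multiplication on `X`. -/
def EveryExtensionIsTVS (Z : Type u) (Y : Type v) [AddCommGroup Z] [Module ℝ Z]
    [TopologicalSpace Z] [AddCommGroup Y] [Module ℝ Y] [TopologicalSpace Y] : Prop :=
  ∀ (X : Type w) [AddCommGroup X] [TopologicalSpace X] [IsTopologicalAddGroup X] [T2Space X]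
    (i : Y →+ X) (π : X →+ Z), IsExtension i π →
    ∃ _ : Module ℝ X, ContinuousSMul ℝ X ∧
      (∀ (c : ℝ) (y : Y), i (c • y) = c • i y) ∧ ∀ (c : ℝ) (x : X), π (c • x) = c • π x

/-! The heart of the matter is that an extension `X` of `Z` by `Y` carries at most one compatible
real structure, forced by its topology, and that this structure exists. Multiplication by a nonzero
integer is bijective on `Y` and `Z`, hence on `X`, so `X` is a rational vector space. If `q ↦ q • x`
is continuous, completeness of `Y` extends it to a one-parameter subgroup `ℝ → X`, and these
subgroups define the scalar multiplication.

The difficulty is to bound `q • x` uniformly for rational `|q| < 1` and small `x`. Choose small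
lifts `σ q` of `q • z`; the error `f q = q • σ 1 - σ q` lies in `Y` but has no evident bound.
Expanding `q` in base `N` with remainders `r k` shows that `f (r k)` equals `N⁻¹ • (f (r (k + 1)) +
v k)` with `v k` small. Iteration gives a sum of the terms `N⁻¹ ^ (k + 1) • v k` and a tail `N⁻¹ ^ n
• f (r n)`. The sum stays small when `Y` has neighbourhoods with `N⁻¹ (V + V) ⊆ V`, as it does when
locally convex or locally bounded. The tail tends to zero because the remainders of a rational
number take finitely many values. This is `IsExtension.eventually_exists_lift`;
`IsExtension.exists_continuousSMul` turns it into the real structure.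

On classes of extensions, the real structure gives surjectivity of the forgetful map. Injectivity
holds because continuous additive maps between real topological vector spaces are linear, and
additivity because the pull-backs and push-outs in the Baer sum are the same with or without
scalars. -/

open scoped Pointwise

/-! ### Rational scalars on a uniquely divisible group -/

/-- A uniquely divisible abelian group is a vector space over `ℚ`. -/
noncomputable abbrev Module.ratOfBijectiveZSMul {X : Type*} [AddCommGroup X]
    (h : ∀ n : ℤ, n ≠ 0 → Function.Bijective fun x : X => n • x) : Module ℚ X :=
  letI : SMul ℚ X := ⟨fun q x =>
    (Equiv.ofBijective _ (h q.den (Int.natCast_ne_zero.2 q.den_nz))).symm (q.num • x)⟩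
  have hden : ∀ (q : ℚ) (x : X), (q.den : ℤ) • (q • x) = q.num • x := fun q x =>
    (Equiv.ofBijective _ (h q.den (Int.natCast_ne_zero.2 q.den_nz))).apply_symm_apply (q.num • x)
  -- Any fraction `m / n` representing `q` computes `q • x`, not only the reduced one; each module
  -- axiom then becomes an identity over a common denominator.
  have hfrac : ∀ (q : ℚ) (m n : ℤ), n ≠ 0 → (m : ℚ) = n * q → ∀ x y : X, n • y = m • x →
      q • x = y := by
    intro q m n hn hq x y hxy
    refine (h (n * q.den) (mul_ne_zero hn (Int.natCast_ne_zero.2 q.den_nz))).1 ?_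
    have hZ : m * q.den = n * q.num := by
      have : (m : ℚ) * q.den = n * q.num := by
        rw [hq, mul_assoc, Rat.mul_den_eq_num]
      exact_mod_cast this
    change (n * q.den) • (q • x) = (n * q.den) • y
    rw [mul_smul, hden, ← mul_smul, ← hZ, mul_comm n, mul_smul, mul_smul, hxy, ← mul_smul,
      ← mul_smul, mul_comm m]
  Module.ofMinimalAxioms
    (fun q x y => hfrac q q.num q.den (Int.natCast_ne_zero.2 q.den_nz) (Rat.den_mul_eq_num q).symm
      _ _ (by rw [smul_add, smul_add, hden, hden]))
    (fun q r x => hfrac (q + r) (q.num * r.den + r.num * q.den) (q.den * r.den)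
      (mul_ne_zero (Int.natCast_ne_zero.2 q.den_nz) (Int.natCast_ne_zero.2 r.den_nz))
      (by
        push_cast
        rw [← Rat.den_mul_eq_num q, ← Rat.den_mul_eq_num r]
        ring) _ _ (by
        rw [smul_add, mul_comm, mul_smul, hden, mul_comm, mul_smul (q.den : ℤ), hden, ← mul_smul,
          ← mul_smul, ← add_smul]
        congr 1
        ring))
    (fun q r x => hfrac (q * r) (q.num * r.num) (q.den * r.den)
      (mul_ne_zero (Int.natCast_ne_zero.2 q.den_nz) (Int.natCast_ne_zero.2 r.den_nz))
      (by
        push_cast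
        rw [← Rat.den_mul_eq_num q, ← Rat.den_mul_eq_num r]
        ring) _ _ (by
        rw [mul_comm, mul_smul, hden, ← mul_smul, mul_comm, mul_smul, hden, ← mul_smul]))
    (fun x => hfrac 1 1 1 one_ne_zero (by norm_num) _ _ rfl)

/-! ### Contracting neighbourhoods -/

/-- For some `N ≥ 2`, zero has arbitrarily small neighbourhoods `V` with `N⁻¹ (V + V) ⊆ V`. -/
def HasContractingNhds (Y : Type*) [AddCommGroup Y] [Module ℝ Y] [TopologicalSpace Y] : Prop :=
  ∃ N : ℕ, 2 ≤ N ∧ ∀ U ∈ 𝓝 (0 : Y), ∃ V ∈ 𝓝 (0 : Y), V ⊆ U ∧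
    ∀ a ∈ V, ∀ b ∈ V, (N : ℝ)⁻¹ • (a + b) ∈ V

section ContractingNhds

variable {Y : Type*} [AddCommGroup Y] [Module ℝ Y]

theorem LocallyConvexSpace.hasContractingNhds [TopologicalSpace Y] [LocallyConvexSpace ℝ Y] :
    HasContractingNhds Y := by
  refine ⟨2, le_rfl, fun U hU => ?_⟩
  obtain ⟨V, ⟨hV, hc⟩, hVU⟩ := (LocallyConvexSpace.convex_basis_zero ℝ Y).mem_iff.1 hU
  refine ⟨V, hV, hVU, fun a ha b hb => ?_⟩
  rw [smul_add]
  exact hc ha hb (by norm_num) (by norm_num) (by norm_num)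

/-- If `B` is a bounded neighbourhood of zero, then so is `B + B`, hence `B + B ⊆ N • B` for large
`N`. This inclusion is invariant under scaling, and the sets `k⁻¹ • B` are arbitrarily small. -/
theorem IsLocallyBounded.hasContractingNhds [TopologicalSpace Y] [IsTopologicalAddGroup Y]
    [ContinuousSMul ℝ Y] (h : IsLocallyBounded Y) : HasContractingNhds Y := by
  obtain ⟨B, hB, hb⟩ := h
  have hnat : Tendsto (fun n : ℕ => (n : ℝ)) atTop (Bornology.cobounded ℝ) :=
    tendsto_norm_atTop_iff_cobounded.1 (by simpa using tendsto_natCast_atTop_atTop (R := ℝ))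
  obtain ⟨N, hN, hN2⟩ :=
    ((hnat.eventually ((hb.add hb) hB)).and (eventually_ge_atTop 2)).exists
  have hN0 : (N : ℝ) ≠ 0 := by positivity
  refine ⟨N, hN2, fun U hU => ?_⟩
  obtain ⟨k, hk, hk1⟩ := ((hnat.eventually (hb hU)).and (eventually_ge_atTop 1)).exists
  have hk0 : (k : ℝ) ≠ 0 := by positivity
  refine ⟨(k : ℝ)⁻¹ • B, (set_smul_mem_nhds_zero_iff (inv_ne_zero hk0)).2 hB, ?_, ?_⟩
  · rw [Set.smul_set_subset_iff₀ (inv_ne_zero hk0), inv_inv]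
    exact hk
  · rintro _ ⟨a, ha, rfl⟩ _ ⟨b, hb, rfl⟩
    obtain ⟨c, hc, hc'⟩ := hN (Set.add_mem_add ha hb)
    refine ⟨c, hc, ?_⟩
    change (k : ℝ)⁻¹ • c = (N : ℝ)⁻¹ • ((k : ℝ)⁻¹ • a + (k : ℝ)⁻¹ • b)
    rw [← smul_add, smul_comm, ← hc', inv_smul_smul₀ hN0]

/-- Horner's scheme: the sum is `c • (x 0 + s)`, where `s` is the same kind of sum for the shifted
sequence. The induction therefore peels off the first term and lets `x` vary. -/
theorem sum_pow_smul_mem_of_contracting {c : ℝ} {V : Set Y} (h0 : (0 : Y) ∈ V)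
    (hV : ∀ a ∈ V, ∀ b ∈ V, c • (a + b) ∈ V) (n : ℕ) (x : ℕ → Y) (hx : ∀ k, x k ∈ V) :
    ∑ k ∈ Finset.range n, c ^ (k + 1) • x k ∈ V := by
  induction n generalizing x with
  | zero => simpa
  | succ n ih =>
    have := hV _ (hx 0) _ (ih (fun k => x (k + 1)) fun k => hx _)
    rw [Finset.sum_range_succ']
    convert this using 1
    rw [smul_add, Finset.smul_sum, add_comm]
    congr 1
    · simp
    · exact Finset.sum_congr rfl fun k _ => by rw [smul_smul, ← pow_succ']

end ContractingNhds

/-! ### Convergence of Cauchy filters in an extension -/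

/-- A Cauchy filter in an extension by a complete group converges if its image does. -/
theorem IsExtension.exists_le_nhds_of_cauchy {H X G : Type*} [AddCommGroup H] [UniformSpace H]
    [IsUniformAddGroup H] [CompleteSpace H] [AddCommGroup X] [UniformSpace X] [IsUniformAddGroup X]
    [AddCommGroup G] [TopologicalSpace G] [IsTopologicalAddGroup G] {i : H →+ X} {π : X →+ G}
    (h : IsExtension i π) {F : Filter X} (hF : Cauchy F) {g : G} (hg : Tendsto π F (𝓝 g)) :
    ∃ x, F ≤ 𝓝 x := by
  obtain ⟨x₀, rfl⟩ := h.isOpenQuotientMap.surjective g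
  -- The translate `F - x₀` may miss the image of `i`, although its image in `G` tends to zero.
  -- Thickening by a neighbourhood filter keeps it Cauchy and, as `π` is open, makes it meet `ker
  -- π`, so that it leaves a Cauchy trace on the complete group `H`.
  let K : Filter X := map (fun p : X × X => p.1 + p.2 - x₀) (F ×ˢ 𝓝 0)
  have hK : Cauchy K := by
    refine (hF.prod cauchy_nhds).map ?_
    exact (uniformContinuous_fst.add uniformContinuous_snd).sub uniformContinuous_const
  have hFK : map (fun x => x - x₀) F ≤ K := by
    have : map (fun x => x - x₀) F = map (fun p : X × X => p.1 + p.2 - x₀) (F ×ˢ pure 0) := by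
      rw [prod_pure, map_map]
      simp [Function.comp_def]
    rw [this]
    exact map_mono (prod_mono le_rfl (pure_le_nhds 0))
  have hi : IsUniformInducing i :=
    AddMonoidHom.isUniformInducing_of_isInducing h.isEmbedding.isInducing
  have hne : (comap i K).NeBot := by
    rw [comap_neBot_iff]
    intro S hS
    obtain ⟨A, hA, W, hW, hAW⟩ := mem_prod_iff.1 (mem_map.1 hS)
    have hW' : (fun w => π x₀ - π w) '' W ∈ 𝓝 (π x₀) := by
      have : (fun w => π x₀ - π w) '' W = (fun w => π x₀ - w) '' (π '' W) := by
        rw [Set.image_image]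
      rw [this]
      have h1 := h.isOpenQuotientMap.isOpenMap.image_mem_nhds hW
      rw [map_zero] at h1
      have := (Homeomorph.subLeft (π x₀)).isOpenMap.image_mem_nhds h1
      simpa using this
    have := hF.1
    obtain ⟨a, haA, w, hw, hwa⟩ := nonempty_of_mem (inter_mem hA (hg hW'))
    have h0 : π (a + w - x₀) = 0 := by
      rw [map_sub, map_add, ← hwa]
      simp
    obtain ⟨y, hy⟩ := (h.exact _).1 h0
    refine ⟨y, ?_⟩
    rw [hy]
    exact hAW (Set.mk_mem_prod haA hw)
  obtain ⟨y, hy⟩ := CompleteSpace.complete (hK.comap' hi.comap_uniformity.le hne)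
  -- The limit of the trace is a cluster point of `K`, and a Cauchy filter converges to its cluster
  -- points.
  have hKy : K ≤ 𝓝 (i y) := by
    refine le_nhds_of_cauchy_adhp hK ?_
    have h1 : map i (comap i K) ≤ 𝓝 (i y) :=
      (map_mono hy).trans h.isEmbedding.continuous.continuousAt
    exact NeBot.mono (hne.map i) (le_inf h1 map_comap_le)
  refine ⟨i y + x₀, ?_⟩
  have : Tendsto (fun x => x - x₀ + x₀) F (𝓝 (i y + x₀)) := by
    have h1 : Tendsto (fun x => x - x₀) F (𝓝 (i y)) := hFK.trans hKy
    exact h1.add tendsto_const_nhds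
  simpa [Tendsto] using this

/-! ### Rational scalars and expansions in base `N` -/

theorem AddMonoidHom.map_rat_smul_real {X Z : Type*} [AddCommGroup X] [Module ℚ X]
    [AddCommGroup Z] [Module ℝ Z] (f : X →+ Z) (q : ℚ) (x : X) : f (q • x) = (q : ℝ) • f x := by
  simpa using map_ratCast_smul f ℚ ℝ q x

theorem AddMonoidHom.map_real_ratCast_smul {Y X : Type*} [AddCommGroup Y] [Module ℝ Y]
    [AddCommGroup X] [Module ℚ X] (f : Y →+ X) (q : ℚ) (y : Y) : f ((q : ℝ) • y) = q • f y := by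
  simpa using map_ratCast_smul f ℝ ℚ q y

/-- The successive remainders of the expansion of `q` in base `N`. -/
def baseRemainder (N : ℕ) (q : ℚ) : ℕ → ℚ
  | 0 => q
  | k + 1 => Int.fract (N * baseRemainder N q k)

theorem baseRemainder_mem {N : ℕ} {q : ℚ} (h0 : 0 ≤ q) (h1 : q < 1) (k : ℕ) :
    0 ≤ baseRemainder N q k ∧ baseRemainder N q k < 1 := by
  cases k with
  | zero => exact ⟨h0, h1⟩
  | succ k => exact ⟨Int.fract_nonneg _, Int.fract_lt_one _⟩

theorem exists_baseRemainder_eq (N : ℕ) (q : ℚ) (k : ℕ) :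
    ∃ m : ℤ, baseRemainder N q k = m / q.den := by
  induction k with
  | zero => exact ⟨q.num, (Rat.num_div_den q).symm⟩
  | succ k ih =>
    obtain ⟨m, hm⟩ := ih
    refine ⟨N * m - ⌊N * baseRemainder N q k⌋ * q.den, ?_⟩
    have : (q.den : ℚ) ≠ 0 := Nat.cast_ne_zero.2 q.den_nz
    change Int.fract (N * baseRemainder N q k) = _
    rw [Int.fract]
    push_cast
    rw [sub_div, mul_div_cancel_right₀ _ this, mul_div_assoc, ← hm]

/-- All remainders are fractions in `[0, 1)` with denominator `q.den`. This is where rationality of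
`q` matters. -/
theorem finite_range_baseRemainder (N : ℕ) {q : ℚ} (h0 : 0 ≤ q) (h1 : q < 1) :
    (Set.range (baseRemainder N q)).Finite := by
  refine ((Set.finite_Icc (0 : ℤ) q.den).image fun m : ℤ => (m : ℚ) / q.den).subset ?_
  rintro _ ⟨k, rfl⟩
  obtain ⟨m, hm⟩ := exists_baseRemainder_eq N q k
  obtain ⟨h2, h3⟩ := baseRemainder_mem (N := N) h0 h1 k
  have : (0 : ℚ) < q.den := Nat.cast_pos.2 q.den_pos
  rw [hm] at h2 h3
  rw [div_lt_one this] at h3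
  rw [le_div_iff₀ this, zero_mul] at h2
  exact ⟨m, ⟨by exact_mod_cast h2, by exact_mod_cast h3.le⟩, hm.symm⟩

theorem eq_pow_smul_add_sum {Y : Type*} [AddCommGroup Y] [Module ℝ Y] {c : ℝ} (f v : ℕ → Y)
    (h : ∀ k, f k = c • (f (k + 1) + v k)) (n : ℕ) :
    f 0 = c ^ n • f n + ∑ k ∈ Finset.range n, c ^ (k + 1) • v k := by
  induction n with
  | zero => simp
  | succ n ih =>
    rw [ih, Finset.sum_range_succ, h n, smul_smul, ← pow_succ, smul_add]
    abel

theorem eventually_pow_smul_mem_of_finite_range {Y : Type*} [AddCommGroup Y] [Module ℝ Y]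
    [TopologicalSpace Y] [ContinuousSMul ℝ Y] {c : ℝ} (hc0 : 0 ≤ c) (hc1 : c < 1) {f : ℕ → Y}
    (hf : (Set.range f).Finite) {U : Set Y} (hU : U ∈ 𝓝 0) : ∀ᶠ n in atTop, c ^ n • f n ∈ U := by
  have : ∀ᶠ n : ℕ in atTop, ∀ y ∈ Set.range f, c ^ n • y ∈ U := by
    rw [Filter.eventually_all_finite hf]
    intro y _
    have h : Tendsto (fun n : ℕ => c ^ n • y) atTop (𝓝 ((0 : ℝ) • y)) :=
      (tendsto_pow_atTop_nhds_zero_of_lt_one hc0 hc1).smul_const y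
    rw [zero_smul] at h
    exact h hU
  exact this.mono fun n hn => hn _ ⟨n, rfl⟩

/-! ### Uniform smallness of rational multiples -/

namespace IsExtension

variable {Y X Z : Type*} [AddCommGroup Y] [Module ℝ Y] [TopologicalSpace Y]
  [ContinuousSMul ℝ Y] [AddCommGroup X] [TopologicalSpace X]
  [IsTopologicalAddGroup X] [AddCommGroup Z] [Module ℝ Z] [TopologicalSpace Z]
  [ContinuousSMul ℝ Z] {i : Y →+ X} {π : X →+ Z}

/-- Vectors close to zero lift to elements whose multiples by `q ∈ [0, 1)` are close to zero. -/
theorem eventually_exists_lift [Module ℚ X] (h : IsExtension i π) (hY : HasContractingNhds Y)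
    {W : Set X} (hW : W ∈ 𝓝 0) :
    ∀ᶠ z in 𝓝 (0 : Z), ∃ x ∈ W, π x = z ∧ ∀ q : ℚ, 0 ≤ q → q < 1 → q • x ∈ W := by
  obtain ⟨N, hN, hcontr⟩ := hY
  have hN0 : (N : ℝ) ≠ 0 := by positivity
  have hNpos : (0 : ℚ) < N := by positivity
  have hc1 : (N : ℝ)⁻¹ < 1 := inv_lt_one_of_one_lt₀ (by exact_mod_cast hN)
  -- In the end `q • σ 1` is `σ q + i (f q)`: one `W₁` receives `σ q`, and `i (f q)` splits into
  -- tail and sum, each in `W₂`.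
  obtain ⟨W₁, hW₁, hW₁W⟩ := exists_nhds_zero_half hW
  obtain ⟨W₂, hW₂, hW₂W⟩ := exists_nhds_zero_half hW₁
  have hi0 : Tendsto i (𝓝 0) (𝓝 0) := by
    simpa using h.isEmbedding.continuous.tendsto 0
  have hU : i ⁻¹' W₂ ∈ 𝓝 (0 : Y) := hi0 hW₂
  obtain ⟨V, hV, hVU, hVc⟩ := hcontr _ hU
  rw [h.isEmbedding.isInducing.nhds_eq_comap, map_zero] at hV
  obtain ⟨V', hV', hV'V⟩ := mem_comap.1 hV
  -- There are only `N` possible digits `d`, so one neighbourhood serves them all.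
  have hcomb : ∀ᶠ p : X × X × X in 𝓝 0, ∀ d ∈ Finset.Ico (0 : ℤ) N,
      p.1 + d • p.2.1 - N • p.2.2 ∈ V' := by
    rw [Filter.eventually_all_finset]
    intro d _
    have : Continuous fun p : X × X × X => p.1 + d • p.2.1 - N • p.2.2 := by fun_prop
    exact this.continuousAt.preimage_mem_nhds (by simpa using hV')
  obtain ⟨A, hA, A', hA', hAA⟩ := mem_nhds_prod_iff.1 hcomb
  obtain ⟨B, hB, B', hB', hBB⟩ := mem_nhds_prod_iff.1 hA'
  have hS : W₁ ∩ (W ∩ (A ∩ (B ∩ B'))) ∈ 𝓝 (0 : X) :=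
    inter_mem hW₁ (inter_mem hW (inter_mem hA (inter_mem hB hB')))
  set S := W₁ ∩ (W ∩ (A ∩ (B ∩ B')))
  have hπS : π '' S ∈ 𝓝 (0 : Z) := by
    simpa using h.isOpenQuotientMap.isOpenMap.image_mem_nhds hS
  filter_upwards [balancedCore_mem_nhds_zero (𝕜 := ℝ) hπS] with z hz
  -- Balancedness supplies the small lifts. Outside `[0, 1]` any lift will do; the endpoint `1` is
  -- included because `σ 1` is the lift sought.
  have hσ : ∀ q : ℚ, ∃ a, π a = (q : ℝ) • z ∧ (0 ≤ q → q ≤ 1 → a ∈ S) := by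
    intro q
    by_cases hq : 0 ≤ q ∧ q ≤ 1
    · have : (q : ℝ) • z ∈ balancedCore ℝ (π '' S) := by
        refine (balancedCore_balanced _).smul_mem ?_ hz
        rw [Real.norm_eq_abs, abs_le]
        have h0 : (0 : ℝ) ≤ q := by exact_mod_cast hq.1
        have h1 : (q : ℝ) ≤ 1 := by exact_mod_cast hq.2
        constructor <;> linarith
      obtain ⟨a, ha, haz⟩ := balancedCore_subset _ this
      exact ⟨a, haz, fun _ _ => ha⟩
    · obtain ⟨a, ha⟩ := h.isOpenQuotientMap.surjective ((q : ℝ) • z)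
      exact ⟨a, ha, fun h0 h1 => (hq ⟨h0, h1⟩).elim⟩
  choose σ hσπ hσS using hσ
  have hx : π (σ 1) = z := by simp [hσπ]
  have hf : ∀ q : ℚ, ∃ y, i y = q • σ 1 - σ q := fun q =>
    (h.exact _).1 (by rw [map_sub, π.map_rat_smul_real, hx, hσπ, sub_self])
  choose f hf using hf
  have hσ1 : σ 1 ∈ S := hσS 1 zero_le_one le_rfl
  refine ⟨σ 1, hσ1.2.1, hx, fun q hq0 hq1 => ?_⟩
  let r : ℕ → ℚ := baseRemainder N q
  have hr : ∀ k, 0 ≤ r k ∧ r k < 1 := baseRemainder_mem hq0 hq1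
  let v : ℕ → Y := fun k => (N : ℝ) • f (r k) - f (r (k + 1))
  have hv : ∀ k, v k ∈ V := by
    intro k
    apply hV'V
    have hr' : r (k + 1) = N * r k - (⌊N * r k⌋ : ℤ) := rfl
    -- With `d = ⌊N * r k⌋`, the large multiples of `σ 1` cancel because `N * r k - r (k + 1) = d`.
    -- Only the `d`-fold multiple of `σ 1` and two other small lifts remain.
    have hiv : i (v k) = σ (r (k + 1)) + ⌊N * r k⌋ • σ 1 - N • σ (r k) := by
      have hiN : i ((N : ℝ) • f (r k)) = N • i (f (r k)) := by
        rw [Nat.cast_smul_eq_nsmul, map_nsmul]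
      have hσ' : r (k + 1) • σ 1 = N • r k • σ 1 - ⌊N * r k⌋ • σ 1 := by
        rw [hr', sub_smul, mul_smul, Nat.cast_smul_eq_nsmul, Int.cast_smul_eq_zsmul]
      rw [map_sub, hiN, hf, hf, hσ', nsmul_sub]
      abel
    rw [Set.mem_preimage, hiv]
    have hS' : σ (r (k + 1)) ∈ S := hσS _ (hr _).1 (hr _).2.le
    have hS'' : σ (r k) ∈ S := hσS _ (hr _).1 (hr _).2.le
    refine hAA (a := (σ (r (k + 1)), σ 1, σ (r k)))
      ⟨hS'.2.2.1, hBB ⟨hσ1.2.2.2.1, hS''.2.2.2.2⟩⟩ ⌊N * r k⌋ ?_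
    rw [Finset.mem_Ico]
    refine ⟨Int.floor_nonneg.2 (mul_nonneg hNpos.le (hr k).1), Int.floor_lt.2 ?_⟩
    have := mul_lt_mul_of_pos_left (hr k).2 hNpos
    simpa using this
  have hrec : ∀ k, f (r k) = (N : ℝ)⁻¹ • (f (r (k + 1)) + v k) := by
    intro k
    rw [add_sub_cancel, inv_smul_smul₀ hN0]
  -- No bound on `f` is available, but finitely many values suffice for the tail to vanish in the
  -- limit.
  have hfin : (Set.range fun k => f (r k)).Finite := by
    rw [show (fun k => f (r k)) = f ∘ r from rfl, Set.range_comp]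
    exact (finite_range_baseRemainder N hq0 hq1).image f
  obtain ⟨n, hn⟩ :=
    (eventually_pow_smul_mem_of_finite_range (by positivity) hc1 hfin hU).exists
  have hV0 : (0 : Y) ∈ V := hV'V (by simpa using mem_of_mem_nhds hV')
  have hsum := hVU (sum_pow_smul_mem_of_contracting hV0 hVc n v hv)
  have hfq : i (f q) ∈ W₁ := by
    have : f q = _ := eq_pow_smul_add_sum (fun k => f (r k)) v hrec n
    rw [this, map_add]
    exact hW₂W _ hn _ hsum
  have : q • σ 1 = σ q + i (f q) := by rw [hf, add_sub_cancel]
  rw [this]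
  exact hW₁W _ (hσS q hq0 hq1.le).1 _ hfq

/-- A small `x` differs from the good lift `x'` of `π x` by a small `i y`. Multiples of `x'` are
controlled by the preceding lemma, those of `y` by a balanced neighbourhood in `Y`. Intersecting `W`
with `-W` handles negative scalars. -/
theorem exists_nhds_rat_smul_mem [Module ℚ X] (h : IsExtension i π) (hY : HasContractingNhds Y)
    {W : Set X} (hW : W ∈ 𝓝 0) :
    ∃ W' ∈ 𝓝 (0 : X), ∀ x ∈ W', ∀ q : ℚ, |q| < 1 → q • x ∈ W := by
  have hW' : W ∩ -W ∈ 𝓝 (0 : X) := inter_mem hW (neg_mem_nhds_zero X hW)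
  obtain ⟨W₁, hW₁, hW₁W⟩ := exists_nhds_zero_half hW'
  have hU : i ⁻¹' W₁ ∈ 𝓝 (0 : Y) :=
    h.isEmbedding.continuous.continuousAt.preimage_mem_nhds (by simpa using hW₁)
  have hV := balancedCore_mem_nhds_zero (𝕜 := ℝ) hU
  rw [h.isEmbedding.isInducing.nhds_eq_comap, map_zero] at hV
  obtain ⟨V, hV, hVU⟩ := mem_comap.1 hV
  obtain ⟨A, hA, hAV⟩ := exists_nhds_half_neg hV
  have hπ : Tendsto π (𝓝 0) (𝓝 0) := by
    simpa using h.isOpenQuotientMap.continuous.tendsto 0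
  refine ⟨A ∩ π ⁻¹' _, inter_mem hA (hπ (h.eventually_exists_lift hY (inter_mem hA hW₁))), ?_⟩
  rintro x ⟨hxA, x', hx'A, hx', hq⟩
  obtain ⟨y, hy⟩ := (h.exact (x - x')).1 (by rw [map_sub, hx', sub_self])
  have hyV : y ∈ balancedCore ℝ (i ⁻¹' W₁) :=
    hVU (by rw [Set.mem_preimage, hy]; exact hAV _ hxA _ hx'A.1)
  have hpos : ∀ q : ℚ, 0 ≤ q → q < 1 → q • x ∈ W ∩ -W := by
    intro q h0 h1
    have : q • x = q • x' + i ((q : ℝ) • y) := by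
      rw [i.map_real_ratCast_smul, hy, ← smul_add, add_sub_cancel]
    rw [this]
    refine hW₁W _ (hq q h0 h1).2 _ ?_
    have h0' : (0 : ℝ) ≤ q := by exact_mod_cast h0
    refine balancedCore_subset (i ⁻¹' W₁) ((balancedCore_balanced _).smul_mem ?_ hyV)
    rw [Real.norm_eq_abs, abs_of_nonneg h0']
    exact_mod_cast h1.le
  intro q hq1
  rcases le_total 0 q with h0 | h0
  · exact (hpos q h0 ((abs_lt.1 hq1).2)).1
  · have := (hpos (-q) (neg_nonneg.2 h0) (by linarith [(abs_lt.1 hq1).1])).2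
    rwa [neg_smul, Set.neg_mem_neg] at this

/-- For large `n`, the vector `π x / (n + 1)` has a lift `x'` in a prescribed neighbourhood, so `x /
(n + 1) = x' + i y`. The multiples of `x'` are uniformly small; `y` need not be small, but real
scalar multiplication on `Y` is continuous. -/
theorem tendsto_rat_smul_zero [Module ℚ X] (h : IsExtension i π) (hY : HasContractingNhds Y)
    (x : X) : Tendsto (fun q : ℚ => q • x) (𝓝 0) (𝓝 0) := by
  intro W hW
  obtain ⟨W₀, hW₀, hW₀W⟩ := exists_nhds_zero_half hW
  obtain ⟨W', hW', hsmul⟩ := h.exists_nhds_rat_smul_mem hY hW₀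
  have hπW : π '' W' ∈ 𝓝 (0 : Z) := by
    simpa using h.isOpenQuotientMap.isOpenMap.image_mem_nhds hW'
  have hcast : Tendsto (fun q : ℚ => (q : ℝ)) (𝓝 0) (𝓝 0) := by
    simpa using Rat.continuous_coe_real.tendsto 0
  have hz : Tendsto (fun n : ℕ => ((n : ℝ) + 1)⁻¹ • π x) atTop (𝓝 0) := by
    have : Tendsto (fun n : ℕ => ((n : ℝ) + 1)⁻¹) atTop (𝓝 0) := by
      simpa using tendsto_one_div_add_atTop_nhds_zero_nat (𝕜 := ℝ)
    simpa using this.smul_const (π x)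
  obtain ⟨n, x', hx', hπx'⟩ := (hz.eventually_mem hπW).exists
  have hn : ((n : ℚ) + 1) ≠ 0 := by positivity
  obtain ⟨y, hy⟩ := (h.exact (((n : ℚ) + 1)⁻¹ • x - x')).1 (by
    rw [map_sub, π.map_rat_smul_real, hπx']
    push_cast
    exact sub_self _)
  have hmul : Tendsto (fun q : ℚ => q * (n + 1)) (𝓝 0) (𝓝 0) := by
    simpa using (continuous_mul_const ((n : ℚ) + 1)).tendsto 0
  have hiy : Tendsto (fun q : ℚ => i (((q * (n + 1) : ℚ) : ℝ) • y)) (𝓝 0) (𝓝 0) := by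
    have := h.isEmbedding.continuous.continuousAt.tendsto.comp ((hcast.comp hmul).smul_const y)
    simpa [Function.comp_def] using this
  have hlt : ∀ᶠ q : ℚ in 𝓝 0, |q * (n + 1)| < 1 := by
    have := hmul.abs
    rw [abs_zero] at this
    exact this.eventually (gt_mem_nhds zero_lt_one)
  rw [mem_map]
  filter_upwards [hlt, hiy.eventually_mem hW₀] with q hq hqy
  have : q • x = (q * (n + 1)) • x' + i (((q * (n + 1) : ℚ) : ℝ) • y) := by
    rw [i.map_real_ratCast_smul, hy, ← smul_add, add_sub_cancel, smul_smul, mul_assoc,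
      mul_inv_cancel₀ hn, mul_one]
  rw [Set.mem_preimage, this]
  exact hW₀W _ (hsmul _ hx' _ hq) _ hqy

end IsExtension

/-! ### From rational to real scalars -/

theorem Rat.eq_of_continuous_of_eq {X : Type*} [TopologicalSpace X] [T2Space X] {f g : ℝ → X}
    (hf : Continuous f) (hg : Continuous g) (h : ∀ q : ℚ, f q = g q) : f = g :=
  Rat.denseRange_cast.equalizer hf hg (funext h)

namespace IsExtension

/-- The five lemma: multiplication by `n` is bijective on the real vector spaces `Y` and `Z`. -/
theorem bijective_zsmul {Y X Z : Type*} [AddCommGroup Y] [Module ℝ Y] [TopologicalSpace Y]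
    [AddCommGroup X] [TopologicalSpace X] [AddCommGroup Z] [Module ℝ Z] [TopologicalSpace Z]
    {i : Y →+ X} {π : X →+ Z} (h : IsExtension i π) {n : ℤ} (hn : n ≠ 0) :
    Function.Bijective fun x : X => n • x := by
  have hn' : (n : ℝ) ≠ 0 := by exact_mod_cast hn
  constructor
  · intro a b hab
    have hab' : n • (a - b) = 0 := by rw [smul_sub, sub_eq_zero]; exact hab
    have h0 : π (a - b) = 0 := by
      have : (n : ℝ) • π (a - b) = 0 := by
        rw [Int.cast_smul_eq_zsmul, ← map_zsmul, hab', map_zero]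
      exact (smul_eq_zero_iff_right hn').1 this
    obtain ⟨y, hy⟩ := (h.exact _).1 h0
    have hy0 : (n : ℝ) • y = 0 := by
      apply h.isEmbedding.injective
      rw [Int.cast_smul_eq_zsmul, map_zsmul, hy, hab', map_zero]
    rw [(smul_eq_zero_iff_right hn').1 hy0, map_zero] at hy
    exact (sub_eq_zero.1 hy.symm)
  · intro x
    obtain ⟨a, ha⟩ := h.isOpenQuotientMap.surjective ((n : ℝ)⁻¹ • π x)
    obtain ⟨y, hy⟩ := (h.exact (x - n • a)).1 (by
      rw [map_sub, map_zsmul, ha, ← Int.cast_smul_eq_zsmul ℝ, smul_inv_smul₀ hn', sub_self])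
    refine ⟨a + i ((n : ℝ)⁻¹ • y), ?_⟩
    change n • (a + i ((n : ℝ)⁻¹ • y)) = x
    rw [smul_add, ← map_zsmul, ← Int.cast_smul_eq_zsmul ℝ n (_ • y), smul_inv_smul₀ hn', hy,
      add_sub_cancel]

/-- In an extension by a complete space with contracting neighbourhoods, every element lies on a
one-parameter subgroup. -/
theorem exists_oneParameterSubgroup {Y X Z : Type*} [AddCommGroup Y] [Module ℝ Y] [UniformSpace Y]
    [IsUniformAddGroup Y] [CompleteSpace Y] [ContinuousSMul ℝ Y]
    [AddCommGroup X] [Module ℚ X] [TopologicalSpace X] [IsTopologicalAddGroup X] [T2Space X]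
    [AddCommGroup Z] [Module ℝ Z] [TopologicalSpace Z] [IsTopologicalAddGroup Z]
    [ContinuousSMul ℝ Z] {i : Y →+ X} {π : X →+ Z} (h : IsExtension i π)
    (hY : HasContractingNhds Y) (x : X) :
    ∃ φ : ℝ →+ X, Continuous φ ∧ ∀ q : ℚ, φ q = q • x := by
  let := IsTopologicalAddGroup.rightUniformSpace X
  have : IsUniformAddGroup X := isUniformAddGroup_of_addCommGroup
  let f : ℚ →+ X := AddMonoidHom.mk' (fun q => q • x) fun q r => add_smul q r x
  have hf : ∀ q, f q = q • x := fun _ => rfl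
  have hfc : UniformContinuous f :=
    uniformContinuous_of_tendsto_zero (h.tendsto_rat_smul_zero hY x)
  have hd := Rat.isDenseEmbedding_coe_real.isDenseInducing
  -- Neither `X` nor `Z` is assumed complete; the limit exists because the images in `Z` converge,
  -- namely to `t • π x`.
  have hlim : ∀ t : ℝ, ∃ a, Tendsto f (comap ((↑) : ℚ → ℝ) (𝓝 t)) (𝓝 a) := by
    intro t
    have hne := hd.comap_nhds_neBot t
    have hF : Cauchy (comap ((↑) : ℚ → ℝ) (𝓝 t)) :=
      cauchy_nhds.comap' Rat.isUniformEmbedding_coe_real.comap_uniformity.le hne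
    refine h.exists_le_nhds_of_cauchy (hF.map hfc) (g := t • π x) ?_
    rw [tendsto_map'_iff]
    have : (π ∘ f : ℚ → Z) = fun q : ℚ => (q : ℝ) • π x := funext fun q => π.map_rat_smul_real q x
    rw [this]
    exact tendsto_comap.smul_const (π x)
  have hc : Continuous (hd.extend f) := hd.continuous_extend hlim
  have hq : ∀ q : ℚ, hd.extend f q = q • x := hd.extend_eq hfc.continuous
  refine ⟨AddMonoidHom.mk' (hd.extend f) fun s t => ?_, hc, hq⟩
  refine Rat.denseRange_cast.induction_on₂ (p := fun s t : ℝ =>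
    hd.extend f (s + t) = hd.extend f s + hd.extend f t) ?_ (fun a b => ?_) s t
  · exact isClosed_eq (hc.comp continuous_add)
      ((hc.comp continuous_fst).add (hc.comp continuous_snd))
  · rw [← Rat.cast_add, hq, hq, hq, add_smul]

/-- The scalar multiple `t • x` is the value at `t` of the one-parameter subgroup through `x`.
Compatibility with `i` and `π`, and the module axioms not already contained in additivity or
normalization of that subgroup, pass from rational to real scalars by density. -/
theorem exists_continuousSMul {Y X Z : Type*} [AddCommGroup Y] [Module ℝ Y] [UniformSpace Y]
    [IsUniformAddGroup Y] [CompleteSpace Y] [ContinuousSMul ℝ Y]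
    [AddCommGroup X] [TopologicalSpace X] [IsTopologicalAddGroup X] [T2Space X]
    [AddCommGroup Z] [Module ℝ Z] [TopologicalSpace Z] [IsTopologicalAddGroup Z]
    [ContinuousSMul ℝ Z] [T2Space Z] {i : Y →+ X} {π : X →+ Z} (h : IsExtension i π)
    (hY : HasContractingNhds Y) :
    ∃ _ : Module ℝ X, ContinuousSMul ℝ X ∧
      (∀ (c : ℝ) (y : Y), i (c • y) = c • i y) ∧ ∀ (c : ℝ) (x : X), π (c • x) = c • π x := by
  let := Module.ratOfBijectiveZSMul fun n hn => h.bijective_zsmul (n := n) hn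
  choose φ hφc hφ using h.exists_oneParameterSubgroup hY
  have hrat : ∀ x t (q : ℚ), φ x (q * t) = q • φ x t := fun x t q =>
    (φ x).map_real_ratCast_smul q t
  let : SMul ℝ X := ⟨fun t x => φ x t⟩
  let m : Module ℝ X := Module.ofMinimalAxioms
    (fun t x y => congrFun (Rat.eq_of_continuous_of_eq (hφc (x + y)) ((hφc x).add (hφc y))
      fun q => by rw [Pi.add_apply, hφ, hφ, hφ, smul_add]) t)
    (fun s t x => map_add (φ x) s t)
    (fun s t x => congrFun (Rat.eq_of_continuous_of_eq (f := fun s => φ x (s * t))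
      ((hφc x).comp (continuous_mul_const t)) (hφc (φ x t)) fun q => by rw [hφ, hrat]) s)
    (fun x => by
      change φ x 1 = x
      rw [← Rat.cast_one, hφ, one_smul])
  have hsmul : ∀ (t : ℝ) (x : X), t • x = φ x t := fun _ _ => rfl
  -- The rational bound survives limits in the scalar once the target neighbourhood is shrunk to a
  -- closed one.
  have hequi : ∀ W ∈ 𝓝 (0 : X), ∃ W' ∈ 𝓝 (0 : X), ∀ x ∈ W', ∀ t : ℝ, |t| < 1 → t • x ∈ W := by
    intro W hW
    obtain ⟨C, hC, hCcl, hCW⟩ := exists_mem_nhds_isClosed_subset hW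
    obtain ⟨W', hW', hq⟩ := h.exists_nhds_rat_smul_mem hY hC
    refine ⟨W', hW', fun x hx t ht => hCW ?_⟩
    have := Rat.isDenseEmbedding_coe_real.isDenseInducing.comap_nhds_neBot t
    have hlim : Tendsto (fun q : ℚ => φ x q) (comap ((↑) : ℚ → ℝ) (𝓝 t)) (𝓝 (φ x t)) :=
      (hφc x).continuousAt.tendsto.comp tendsto_comap
    refine hCcl.mem_of_tendsto hlim ?_
    have hev : ∀ᶠ s : ℝ in 𝓝 t, |s| < 1 := continuous_abs.continuousAt.eventually (gt_mem_nhds ht)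
    filter_upwards [tendsto_comap.eventually hev] with q hq1
    rw [hφ]
    exact hq x hx q (by exact_mod_cast hq1)
  refine ⟨m, ContinuousSMul.of_nhds_zero ?_ ?_ ?_, ?_, ?_⟩
  · intro W hW
    obtain ⟨W', hW', ht⟩ := hequi W hW
    have hev : ∀ᶠ s : ℝ in 𝓝 0, |s| < 1 :=
      continuous_abs.continuousAt.eventually (gt_mem_nhds (by simp))
    rw [mem_map]
    filter_upwards [prod_mem_prod hev hW'] with p hp
    exact ht _ hp.2 _ hp.1
  · intro x
    have := (hφc x).tendsto 0
    rwa [map_zero] at this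
  · intro a W hW
    obtain ⟨n, hn⟩ := exists_nat_gt |a|
    have hn0 : (0 : ℝ) < n := (abs_nonneg a).trans_lt hn
    -- Writing `a = n * (a / n)` with `|a / n| < 1` reduces to `hequi` and continuity of the integer
    -- multiple.
    have hW₁ : (fun x : X => n • x) ⁻¹' W ∈ 𝓝 0 :=
      (continuous_nsmul n).continuousAt.preimage_mem_nhds (by simpa using hW)
    obtain ⟨W', hW', ht⟩ := hequi _ hW₁
    rw [mem_map]
    filter_upwards [hW'] with x hx
    have := ht x hx (a / n) (by rwa [abs_div, abs_of_pos hn0, div_lt_one hn0])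
    rw [Set.mem_preimage, ← Nat.cast_smul_eq_nsmul ℝ, smul_smul, mul_div_cancel₀ _ hn0.ne'] at this
    exact this
  · intro c y
    refine congrFun (Rat.eq_of_continuous_of_eq (f := fun c : ℝ => i (c • y)) ?_ (hφc (i y))
      fun q => ?_) c
    · exact h.isEmbedding.continuous.comp (continuous_id.smul continuous_const)
    · rw [hφ, i.map_real_ratCast_smul]
  · intro c x
    refine congrFun (Rat.eq_of_continuous_of_eq (f := fun c : ℝ => π (φ x c))
      (g := fun c : ℝ => c • π x) ?_ ?_ fun q => ?_) c
    · exact h.isOpenQuotientMap.continuous.comp (hφc x)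
    · exact continuous_id.smul continuous_const
    · rw [hφ, π.map_rat_smul_real]

end IsExtension

theorem everyExtensionIsTVS_of_hasContractingNhds (Y : Type v) [AddCommGroup Y] [Module ℝ Y]
    [UniformSpace Y] [IsUniformAddGroup Y] [CompleteSpace Y] [ContinuousSMul ℝ Y]
    (hY : HasContractingNhds Y) (Z : Type u) [AddCommGroup Z] [Module ℝ Z] [TopologicalSpace Z]
    [IsTopologicalAddGroup Z] [ContinuousSMul ℝ Z] [T2Space Z] :
    EveryExtensionIsTVS.{u, v, w} Z Y :=
  fun _ _ _ _ _ _ _ h => h.exists_continuousSMul hY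

/-! ### The forgetful map on classes of extensions -/

namespace TVSExt

variable {Z Z' : Type u} {Y Y' : Type v}
  [AddCommGroup Z] [Module ℝ Z] [TopologicalSpace Z]
  [AddCommGroup Z'] [Module ℝ Z'] [TopologicalSpace Z']
  [AddCommGroup Y] [Module ℝ Y] [TopologicalSpace Y]
  [AddCommGroup Y'] [Module ℝ Y'] [TopologicalSpace Y']

/-- Both middle groups are the same subset of `E.X × Z'`, so the identity is the equivalence.
Keeping `s` apart from `t` allows `GroupExt.diag` to be used directly. -/
theorem pullback_toGroupExt_equivalent [T2Space Z'] [IsTopologicalAddGroup Z']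
    [ContinuousSMul ℝ Z'] (E : TVSExt Z Y) (t : Z' →L[ℝ] Z) (s : Z' →ₜ+ Z)
    (hst : ∀ z, s z = t z) :
    (E.pullback t).toGroupExt.Equivalent (E.toGroupExt.pullback s) := by
  let S : (E.pullback t).X →+ (E.toGroupExt.pullback s).X :=
    (Submodule.subtype _).toAddMonoidHom.codRestrict _ fun x => x.2.trans (hst _).symm
  have hS : Continuous S := Continuous.subtype_mk continuous_subtype_val _
  exact ⟨⟨S, hS⟩, fun _ => rfl, fun _ => rfl⟩

theorem pushout_toGroupExt_equivalent [T2Space Z] [IsTopologicalAddGroup Y']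
    [ContinuousSMul ℝ Y'] [T2Space Y'] (E : TVSExt Z Y) (t : Y →L[ℝ] Y') (s : Y →ₜ+ Y')
    (hst : ∀ y, s y = t y) :
    (E.pushout t).toGroupExt.Equivalent (E.toGroupExt.pushout s) := by
  let q : Y' × E.X →+ (E.toGroupExt.pushout s).X :=
    QuotientAddGroup.mk' (E.toGroupExt.pushoutRel s)
  have hq : Continuous q :=
    (QuotientAddGroup.isOpenQuotientMap_mk (N := E.toGroupExt.pushoutRel s)).continuous
  let S : (Y' × E.X) ⧸ E.pushoutRel t →+ (E.toGroupExt.pushout s).X :=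
    QuotientAddGroup.lift (E.pushoutRel t).toAddSubgroup q (by
      rintro _ ⟨y, rfl⟩
      refine (QuotientAddGroup.eq_zero_iff (N := E.toGroupExt.pushoutRel s) _).2 ?_
      exact ⟨y, Prod.ext (hst y) rfl⟩)
  have hS : Continuous S :=
    (E.pushoutRel t).isOpenQuotientMap_mkQ.continuous_comp_iff.1 hq
  refine ⟨⟨S, hS⟩, fun _ => rfl, fun x => ?_⟩
  obtain ⟨a, rfl⟩ := (E.pushoutRel t).mkQ_surjective x
  rfl

theorem baerSum_toGroupExt_equivalent [IsTopologicalAddGroup Z] [ContinuousSMul ℝ Z] [T2Space Z]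
    [IsTopologicalAddGroup Y] [ContinuousSMul ℝ Y] [T2Space Y] (E₁ E₂ : TVSExt Z Y) :
    (E₁.baerSum E₂).toGroupExt.Equivalent (E₁.toGroupExt.baerSum E₂.toGroupExt) :=
  GroupExt.equivalence.trans
    (pushout_toGroupExt_equivalent _ _ (GroupExt.codiag Y) fun _ => rfl)
    (GroupExt.pushout_congr _
      (pullback_toGroupExt_equivalent (E₁.prod E₂) _ (GroupExt.diag Z) fun _ => rfl))

/-- The same `T` works: a continuous additive map between real topological vector spaces is linear.
-/
theorem equivalent_of_toGroupExt {E E' : TVSExt Z Y} (h : E.toGroupExt.Equivalent E'.toGroupExt) :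
    E.Equivalent E' := by
  obtain ⟨T, hi, hπ⟩ := h
  exact ⟨AddMonoidHom.toRealLinearMap (E := E.X) (F := E'.X) T.toAddMonoidHom
    T.continuous_toFun, hi, hπ⟩

end TVSExt

theorem GroupExt.exists_toGroupExt_eq {Z : Type u} {Y : Type v} [AddCommGroup Z] [Module ℝ Z]
    [TopologicalSpace Z] [AddCommGroup Y] [Module ℝ Y] [TopologicalSpace Y]
    (h : EveryExtensionIsTVS.{u, v, max u v} Z Y) (E : GroupExt Z Y) :
    ∃ E' : TVSExt Z Y, E'.toGroupExt = E := by
  obtain ⟨m, hc, hi, hπ⟩ := h E.X E.incl E.proj E.isExtension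
  exact ⟨{ X := E.X
           incl := { E.incl with map_smul' := hi }
           proj := { E.proj with map_smul' := hπ }
           isExtension := E.isExtension }, rfl⟩

theorem forgetIsIso_of_everyExtensionIsTVS {Z : Type u} {Y : Type v} [AddCommGroup Z] [Module ℝ Z]
    [TopologicalSpace Z] [IsTopologicalAddGroup Z] [ContinuousSMul ℝ Z] [T2Space Z]
    [AddCommGroup Y] [Module ℝ Y] [TopologicalSpace Y] [IsTopologicalAddGroup Y]
    [ContinuousSMul ℝ Y] [T2Space Y] (h : EveryExtensionIsTVS.{u, v, max u v} Z Y) :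
    ForgetIsIso Z Y := by
  let f : ExtTVS Z Y → ExtGroup Z Y :=
    Quotient.map TVSExt.toGroupExt fun _ _ hE => hE.toGroupExt
  have hf : Function.Bijective f := by
    constructor
    · rintro ⟨E⟩ ⟨E'⟩ hEE'
      exact Quotient.sound (TVSExt.equivalent_of_toGroupExt (Quotient.exact hEE'))
    · rintro ⟨E⟩
      obtain ⟨E', rfl⟩ := E.exists_toGroupExt_eq h
      exact ⟨E'.toExt, rfl⟩
  refine ⟨{ Equiv.ofBijective f hf with map_add' := ?_ }, fun _ => rfl⟩
  rintro ⟨E⟩ ⟨E'⟩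
  exact Quotient.sound (TVSExt.baerSum_toGroupExt_equivalent E E')

theorem corollary5p4
    (Y : Type v) [AddCommGroup Y] [Module ℝ Y] [UniformSpace Y] [IsUniformAddGroup Y]
    [ContinuousSMul ℝ Y] [T2Space Y]
    (Z : Type u) [AddCommGroup Z] [Module ℝ Z] [TopologicalSpace Z] [IsTopologicalAddGroup Z]
    [ContinuousSMul ℝ Z] [T2Space Z] :
    (IsFrechet Y → TopologicalSpace.MetrizableSpace Z →
      ForgetIsIso Z Y ∧ EveryExtensionIsTVS.{u, v, w} Z Y) ∧
    (CompleteSpace Y → IsLocallyBounded Y → IsLocallyBounded Z →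
      ForgetIsIso Z Y ∧ EveryExtensionIsTVS.{u, v, w} Z Y) := by
  -- The existence of scalars is used at two universe levels: `max u v` for the representatives of
  -- classes, and `w` for the second assertion.
  have key : CompleteSpace Y → HasContractingNhds Y →
      ForgetIsIso Z Y ∧ EveryExtensionIsTVS.{u, v, w} Z Y := fun _ hY =>
    ⟨forgetIsIso_of_everyExtensionIsTVS (everyExtensionIsTVS_of_hasContractingNhds Y hY Z),
      everyExtensionIsTVS_of_hasContractingNhds Y hY Z⟩
  refine ⟨fun hY _ => ?_, fun hc hY _ => key hc hY.hasContractingNhds⟩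
  have := hY.locallyConvex
  exact key hY.complete LocallyConvexSpace.hasContractingNhds
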